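/- Let $k$ be a commutative artinian ring, let $E$ be the minimal injective cogenerator of $k$ (an injective envelope of the direct sum of the simple $k$-modules $k/\mathfrak m$), and put $D=\operatorname{Hom}_k(-,E)$. Let $\mathcal A$ be a Hom-finite $k$-linear abelian category. A morphism is projectively trivial if it factors through every epimorphism ending at its target, and injectively trivial if it factors through every monomorphism starting at its source; let $\underline{\mathcal A}$ and $\overline{\mathcal A}$ be the quotients of $\mathcal A$ by the ideals of projectively, respectively injectively, trivial morphisms, with Hom-modules $\underline{\operatorname{Hom}}$ and $\overline{\operatorname{Hom}}$. Assume that $\mathcal A$ has Auslander–Reiten duality, i.e. there are a $k$-linear equivalence $\tau\colon\underline{\mathcal A}\to\overline{\mathcal A}$ and $k$-linear isomorphisms $\Phi_{X,Y}\colon D\operatorname{Ext}^1_{\mathcal A}(X,Y)\to\overline{\operatorname{Hom}}(Y,\tau X)$, natural in $X$ and $Y$. Fix a quasi-inverse $\tau^{-1}$ of $\tau$ and a natural isomorphism $\varepsilon\colon\tau^{-1}\tau\to\mathrm{Id}$, and let $\Psi_{X,Y}\colon D\operatorname{Ext}^1_{\mathcal A}(X,Y)\to\underline{\operatorname{Hom}}(\tau^{-1}Y,X)$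 be the isomorphism $\varphi\mapsto\varepsilon_X\circ\tau^{-1}(\Phi_{X,Y}(\varphi))$. Let $K,Y$ be objects, let $K'$ be a direct summand of a finite direct sum of copies of $K$, and put $C=\tau^{-1}K$, $C'=\tau^{-1}K'$ and $\Gamma(C)=\operatorname{End}_{\mathcal A}(C)$. Two morphisms to $Y$ are right equivalent if each factors through the other; $[\alpha\rangle$ denotes the right equivalence class of $\alpha$. A morphism $\alpha$ to $Y$ is right $C$-determined if every $t\colon T\to Y$ such that $t\circ\phi$ factors through $\alpha$ for all $\phi\colon C\to T$ factors through $\alpha$. Let ${}^C[\to Y\rangle_{\rm epi}$ be the set of right equivalence classes of epimorphisms to $Y$ that are right $C$-determined, and let $\operatorname{sub}_{\Gamma(C)^{\rm op}}M$ be the set of finitely generated $\Gamma(C)^{\rm op}$-submodules of $M$. Consider the composite $$F\colon D\underline{\operatorname{Hom}}(C',Y)\xrightarrow{D\Psi_{Y,K'}}\operatorname{Ext}^1_{\mathcal A}(Y,K')\xrightarrow{\ \kappa\ }{}^C[\to Y\rangle_{\rm epi}\xrightarrow{\ \eta_{C,Y}\ }\operatorname{sub}_{\Gamma(C)^{\rm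 op}}\underline{\operatorname{Hom}}(C,Y),$$ where $DD\operatorname{Ext}^1_{\mathcal A}(Y,K')$ is identified with $\operatorname{Ext}^1_{\mathcal A}(Y,K')$ by evaluation, $\kappa$ sends the class of an exact sequence $0\to K'\to X\xrightarrow{\alpha}Y\to0$ to $[\alpha\rangle$, and $\eta_{C,Y}([\alpha\rangle)$ is the image of $\underline{\operatorname{Hom}}(C,\alpha)\colon\underline{\operatorname{Hom}}(C,X)\to\underline{\operatorname{Hom}}(C,Y)$. Then for every $k$-linear map $\theta\colon\underline{\operatorname{Hom}}(C',Y)\to E$, $$F(\theta)=\{f\in\underline{\operatorname{Hom}}(C,Y)\mid\theta(f\circ g)=0\text{ for every morphism }g\colon C'\to C\}.$$ -/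

import Mathlib

open CategoryTheory Limits Abelian
open scoped DirectSum

universe w v u t

set_option linter.unusedSectionVars false

namespace AuslanderBij

/-! ### Matlis duality over an artinian ring -/

/-- `E` is a minimal injective cogenerator of `k`: an injective envelope of the direct sum of a
full set `k ⧸ m` (`m` a maximal ideal) of representatives of the simple `k`-modules. The range of
the embedding is an essential submodule. -/
structure IsMinimalInjectiveCogenerator (k : Type t) [CommRing k] (E : Type t) [AddCommGroup E]
    [Module k E] : Prop where
  injective : Module.Injective k E
  exists_essential_embedding : ∃ i : (⨁ m : MaximalSpectrum k, k ⧸ m.asIdeal) →ₗ[k] E,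
    Function.Injective i ∧ ∀ N : Submodule k E, N ≠ ⊥ → N ⊓ LinearMap.range i ≠ ⊥

section Duality

variable {k : Type t} [CommRing k] {E : Type t} [AddCommGroup E] [Module k E]

theorem IsMinimalInjectiveCogenerator.exists_extend (hE : IsMinimalInjectiveCogenerator k E)
    {M N : Type*} [AddCommGroup M] [Module k M] [AddCommGroup N] [Module k N]
    (f : M →ₗ[k] N) (hf : Function.Injective f) (g : M →ₗ[k] E) :
    ∃ h : N →ₗ[k] E, h ∘ₗ f = g :=
  (Module.Baer.of_injective hE.injective).extension_property f hf g

theorem IsMinimalInjectiveCogenerator.exists_ne_zero (hE : IsMinimalInjectiveCogenerator k E)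
    {M : Type*} [AddCommGroup M] [Module k M] {x : M} (hx : x ≠ 0) :
    ∃ φ : M →ₗ[k] E, φ x ≠ 0 := by
  classical
  obtain ⟨i, hi, -⟩ := hE.exists_essential_embedding
  have hI : LinearMap.ker (LinearMap.toSpanSingleton k M x) ≠ ⊤ := by
    intro h
    apply hx
    have : (1 : k) ∈ LinearMap.ker (LinearMap.toSpanSingleton k M x) := h ▸ Submodule.mem_top
    simpa using this
  obtain ⟨m, hm, hle⟩ := Ideal.exists_le_maximal _ hI
  let μ : MaximalSpectrum k := ⟨m, hm⟩
  let g : k →ₗ[k] E := i ∘ₗ DirectSum.lof k _ (fun m : MaximalSpectrum k => k ⧸ m.asIdeal) μ ∘ₗ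
    Submodule.mkQ m
  have hg : LinearMap.ker (LinearMap.toSpanSingleton k M x) ≤ LinearMap.ker g := by
    intro a ha
    have : Submodule.mkQ m a = 0 := by
      rw [Submodule.mkQ_apply, Submodule.Quotient.mk_eq_zero]; exact hle ha
    simp [g, this]
  have hg1 : g 1 ≠ 0 := by
    intro h
    have h2 := hi (h.trans (map_zero i).symm)
    have h3 := DirectSum.of_injective (β := fun m : MaximalSpectrum k => k ⧸ m.asIdeal) μ
      (h2.trans (map_zero _).symm)
    erw [Submodule.Quotient.mk_eq_zero] at h3
    exact hm.ne_top ((Ideal.eq_top_iff_one _).2 h3)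
  obtain ⟨φ, hφ⟩ := hE.exists_extend
    (Submodule.liftQ _ (LinearMap.toSpanSingleton k M x) le_rfl)
    (by rw [← LinearMap.ker_eq_bot]; exact Submodule.ker_liftQ_eq_bot _ _ _ le_rfl)
    (Submodule.liftQ _ g hg)
  refine ⟨φ, fun h => hg1 ?_⟩
  have := LinearMap.congr_fun hφ (Submodule.Quotient.mk 1)
  simp only [LinearMap.comp_apply, Submodule.liftQ_apply, LinearMap.toSpanSingleton_apply,
    one_smul] at this
  rw [← this, h]

theorem IsMinimalInjectiveCogenerator.length_dual_simple (hE : IsMinimalInjectiveCogenerator k E)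
    (S : Type*) [AddCommGroup S] [Module k S] [IsSimpleModule k S] :
    Module.length k (S →ₗ[k] E) ≤ 1 := by
  classical
  obtain ⟨i, hi, hess⟩ := hE.exists_essential_embedding
  obtain ⟨m, hm, ⟨eS⟩⟩ := isSimpleModule_iff_quot_maximal.1 ‹IsSimpleModule k S›
  let μ : MaximalSpectrum k := ⟨m, hm⟩
  let j : (k ⧸ m) →ₗ[k] E :=
    i ∘ₗ DirectSum.lof k _ (fun m : MaximalSpectrum k => k ⧸ m.asIdeal) μ
  have key : ∀ e : E, (∀ a ∈ m, a • e = 0) → e ∈ LinearMap.range j := by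
    intro e he
    by_cases he0 : e = 0
    · rw [he0]; exact Submodule.zero_mem _
    have hne : Submodule.span k {e} ≠ ⊥ := by simpa using he0
    obtain ⟨z, ⟨hz1, ⟨y, hy⟩⟩, hz0⟩ := (Submodule.ne_bot_iff _).1 (hess _ hne)
    obtain ⟨r, rfl⟩ := Submodule.mem_span_singleton.1 hz1
    have hr : r ∉ m := fun h => hz0 (he r h)
    obtain ⟨r', hr'⟩ := Ideal.Quotient.exists_inv (I := m)
      (a := Ideal.Quotient.mk m r) (by rwa [ne_eq, Ideal.Quotient.eq_zero_iff_mem])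
    obtain ⟨r', rfl⟩ := Ideal.Quotient.mk_surjective r'
    have hmem : r' * r - 1 ∈ m := by
      rw [← Ideal.Quotient.eq_zero_iff_mem, map_sub, map_mul, map_one, mul_comm, hr', sub_self]
    have hee : e = i (r' • y) := by
      have := he _ hmem
      rw [sub_smul, one_smul, mul_smul, sub_eq_zero] at this
      rw [map_smul, hy, this]
    have hyk : ∀ a ∈ m, a • (r' • y) = 0 := by
      intro a ha
      apply hi
      rw [map_smul, ← hee, he a ha, map_zero]
    refine ⟨(r' • y) μ, ?_⟩
    rw [hee]
    change i _ = i _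
    congr 1
    ext ν
    by_cases hν : ν = μ
    · subst hν
      rw [DirectSum.lof_eq_of, DirectSum.of_eq_same]
    · rw [DirectSum.lof_eq_of, DirectSum.of_eq_of_ne _ _ _ hν]
      have : ¬ m ≤ ν.asIdeal := by
        intro hle
        exact hν (MaximalSpectrum.ext (hm.eq_of_le ν.isMaximal.ne_top hle).symm)
      obtain ⟨a, ha, ha'⟩ := Set.not_subset.1 this
      have h0 : a • ((r' • y) ν) = 0 := by
        rw [← DirectSum.smul_apply, hyk a ha]; rfl
      obtain ⟨q, hq⟩ := Ideal.Quotient.mk_surjective ((r' • y) ν)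
      rw [← hq] at h0 ⊢
      have h1 : Ideal.Quotient.mk ν.asIdeal (a * q) = 0 := h0
      rw [Ideal.Quotient.eq_zero_iff_mem] at h1
      have hp := ν.isMaximal.isPrime.mem_or_mem h1
      exact (Ideal.Quotient.eq_zero_iff_mem.2 (hp.resolve_left ha')).symm
  let s0 : S := eS.symm (Submodule.Quotient.mk 1)
  have hs0 : ∀ a ∈ m, a • s0 = 0 := by
    intro a ha
    rw [← map_smul, ← Submodule.Quotient.mk_smul, smul_eq_mul, mul_one,
      (Submodule.Quotient.mk_eq_zero m).2 ha, map_zero]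
  let ev : (S →ₗ[k] E) →ₗ[k] LinearMap.range j :=
    LinearMap.codRestrict _ (LinearMap.applyₗ s0) (fun φ => key _ fun a ha => by
      change a • φ s0 = 0
      rw [← map_smul, hs0 a ha, map_zero])
  have hev : Function.Injective ev := by
    rw [← LinearMap.ker_eq_bot, LinearMap.ker_eq_bot']
    intro φ hφ
    have h0 : φ s0 = 0 := congrArg Subtype.val hφ
    ext s
    obtain ⟨q, hq⟩ := Submodule.Quotient.mk_surjective m (eS s)
    have : s = q • s0 := by
      apply eS.injective
      rw [map_smul, ← hq]
      simp only [s0, LinearEquiv.apply_symm_apply]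
      rw [← Submodule.Quotient.mk_smul, smul_eq_mul, mul_one]
    rw [this, map_smul, h0, smul_zero, LinearMap.zero_apply]
  have : IsSimpleModule k (k ⧸ m) := isSimpleModule_iff_quot_maximal.2 ⟨m, hm, ⟨.refl _ _⟩⟩
  calc Module.length k (S →ₗ[k] E) ≤ Module.length k (LinearMap.range j) :=
        Module.length_le_of_injective ev hev
    _ ≤ Module.length k (k ⧸ m) :=
        Module.length_le_of_surjective j.rangeRestrict j.surjective_rangeRestrict
    _ = 1 := Module.length_eq_one _ _

theorem IsMinimalInjectiveCogenerator.length_dual_le (hE : IsMinimalInjectiveCogenerator k E)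
    {M : Type*} [AddCommGroup M] [Module k M] (hM : IsFiniteLength k M) :
    Module.length k (M →ₗ[k] E) ≤ Module.length k M := by
  induction hM with
  | of_subsingleton =>
    rw [Module.length_eq_zero_iff.2]
    · exact zero_le
    · exact ⟨fun f g => LinearMap.ext fun x => by
        rw [Subsingleton.elim x 0, map_zero, map_zero]⟩
  | @of_simple_quotient M _ _ N _ hN ih =>
    let a : ((M ⧸ N) →ₗ[k] E) →ₗ[k] (M →ₗ[k] E) := LinearMap.lcomp k E N.mkQ
    let b : (M →ₗ[k] E) →ₗ[k] (N →ₗ[k] E) := LinearMap.lcomp k E N.subtype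
    have hab : Function.Exact a b.rangeRestrict := by
      intro f
      constructor
      · intro hf
        have hf' : b f = 0 := congrArg Subtype.val hf
        refine ⟨N.liftQ f fun x hx => LinearMap.congr_fun hf' ⟨x, hx⟩, ?_⟩
        ext x
        rfl
      · rintro ⟨g, rfl⟩
        apply Subtype.ext
        ext x
        change g (N.mkQ x) = 0
        rw [Submodule.mkQ_apply, (Submodule.Quotient.mk_eq_zero N).2 x.2, map_zero]
    have ha : Function.Injective a := by
      intro f g hfg
      ext x
      exact LinearMap.congr_fun hfg x
    rw [Module.length_eq_add_of_exact a b.rangeRestrict ha b.surjective_rangeRestrict hab,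
      Module.length_eq_add_of_exact N.subtype N.mkQ N.injective_subtype N.mkQ_surjective
        (LinearMap.exact_subtype_mkQ N), Module.length_eq_one k (M ⧸ N), add_comm]
    exact add_le_add ((Module.length_le_of_injective _ (Submodule.injective_subtype _)).trans ih)
      (hE.length_dual_simple _)

theorem IsMinimalInjectiveCogenerator.eval_injective (hE : IsMinimalInjectiveCogenerator k E)
    (M : Type*) [AddCommGroup M] [Module k M] :
    Function.Injective (LinearMap.applyₗ : M →ₗ[k] (M →ₗ[k] E) →ₗ[k] E) := by
  rw [← LinearMap.ker_eq_bot, LinearMap.ker_eq_bot']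
  intro x hx
  by_contra h
  obtain ⟨φ, hφ⟩ := hE.exists_ne_zero h
  exact hφ (LinearMap.congr_fun hx φ)

/-- If `D M` is finitely generated over the artinian ring `k`, then the evaluation map
`M → D (D M)` is bijective, where `D = Hom_k(-, E)`. -/
theorem IsMinimalInjectiveCogenerator.eval_bijective [IsArtinianRing k]
    (hE : IsMinimalInjectiveCogenerator k E)
    (M : Type*) [AddCommGroup M] [Module k M] [Module.Finite k (M →ₗ[k] E)] :
    Function.Bijective (LinearMap.applyₗ : M →ₗ[k] (M →ₗ[k] E) →ₗ[k] E) := by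
  refine ⟨hE.eval_injective M, ?_⟩
  have h1 : IsFiniteLength k (M →ₗ[k] E) :=
    isFiniteLength_iff_isNoetherian_isArtinian.2 ⟨inferInstance, inferInstance⟩
  have h2 : IsFiniteLength k ((M →ₗ[k] E) →ₗ[k] E) := by
    rw [← Module.length_ne_top_iff] at h1 ⊢
    exact ne_top_of_le_ne_top h1
      (hE.length_dual_le (Module.length_ne_top_iff.1 h1))
  have h3 : IsFiniteLength k M := h2.of_injective (hE.eval_injective M)
  have := (isFiniteLength_iff_isNoetherian_isArtinian.1 h2).1
  have := (isFiniteLength_iff_isNoetherian_isArtinian.1 h2).2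
  rw [← LinearMap.range_eq_top]
  by_contra hne
  have h4 := Submodule.length_lt hne
  have h5 : Module.length k M ≤ Module.length k
      (LinearMap.range (LinearMap.applyₗ : M →ₗ[k] (M →ₗ[k] E) →ₗ[k] E)) :=
    Module.length_le_of_injective (LinearMap.applyₗ.rangeRestrict)
      ((LinearMap.injective_rangeRestrict_iff _).2 (hE.eval_injective M))
  exact absurd (h4.trans_le ((hE.length_dual_le h1).trans (hE.length_dual_le h3)))
    (not_lt.2 h5)

end Duality

/-! ### Extensions and the groups Ext¹ -/

theorem exists_shortExact_extClass {A : Type u} [Category.{v} A] [Abelian A] [HasExt.{w} A]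
    {Y K : A} (x : Ext Y K 1) :
    ∃ (X : A) (i : K ⟶ X) (p : X ⟶ Y) (h : i ≫ p = 0)
      (hS : (ShortComplex.mk i p h).ShortExact), hS.extClass = x := by
  let := HasDerivedCategory.standard A
  let s := DerivedCategory.singleFunctor A 0
  let tt := DerivedCategory.TStructure.t (C := A)
  have hLE1 : ∀ W : A, tt.IsLE ((s.obj W)⟦(1 : ℤ)⟧) (-1) := fun W =>
    have : tt.IsLE (s.obj W) 0 := inferInstanceAs ((s.obj W).IsLE 0)
    tt.isLE_shift _ 0 1 (-1)
  have hGE0 : ∀ W : A, tt.IsGE (s.obj W) 0 := fun W => inferInstanceAs ((s.obj W).IsGE 0)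
  have hLE0 : ∀ W : A, tt.IsLE (s.obj W) 0 := fun W => inferInstanceAs ((s.obj W).IsLE 0)
  let x' : s.obj Y ⟶ (s.obj K)⟦(1 : ℤ)⟧ := x.hom
  obtain ⟨Z, f, g, hT⟩ := Pretriangulated.distinguished_cocone_triangle₂ x'
  have hZG : Z.IsGE 0 := tt.isGE₂ _ hT 0 (hGE0 K) (hGE0 Y)
  have hZL : Z.IsLE 0 := tt.isLE₂ _ hT 0 (hLE0 K) (hLE0 Y)
  obtain ⟨X, ⟨e⟩⟩ := Z.exists_iso_singleFunctor_obj_of_isGE_of_isLE 0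
  obtain ⟨i, hi⟩ := s.map_surjective (f ≫ e.hom)
  obtain ⟨p, hp⟩ := s.map_surjective (e.inv ≫ g)
  have hT' : Pretriangulated.Triangle.mk (s.map i) (s.map p) x' ∈
      (Pretriangulated.distinguishedTriangles : Set (Pretriangulated.Triangle (DerivedCategory A))) := by
    refine Pretriangulated.isomorphic_distinguished _ hT _ ?_
    refine Pretriangulated.Triangle.isoMk _ _ (Iso.refl _) e.symm (Iso.refl _) ?_ ?_ ?_
    · change s.map i ≫ e.inv = 𝟙 (s.obj K) ≫ f
      rw [hi, Category.assoc, e.hom_inv_id, Category.comp_id, Category.id_comp]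
    · change s.map p ≫ 𝟙 (s.obj Y) = e.inv ≫ g
      rw [hp, Category.comp_id]
    · change x' ≫ (𝟙 (s.obj K))⟦(1 : ℤ)⟧' = 𝟙 (s.obj Y) ≫ x'
      rw [CategoryTheory.Functor.map_id, Category.comp_id, Category.id_comp]
  have y3 : ∀ {W : DerivedCategory A} (h : s.obj Y ⟶ W), s.map p ≫ h = 0 →
      ∃ q : (s.obj K)⟦(1 : ℤ)⟧ ⟶ W, h = x' ≫ q :=
    fun h hh => Pretriangulated.Triangle.yoneda_exact₃ _ hT' h hh
  have c1 : ∀ {W : DerivedCategory A} (h : W ⟶ (s.obj K)⟦(1 : ℤ)⟧), h ≫ (s.map i)⟦(1 : ℤ)⟧' = 0 →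
      ∃ q : W ⟶ s.obj Y, h = q ≫ x' :=
    fun h hh => Pretriangulated.Triangle.coyoneda_exact₁ _ hT' h hh
  have c2 : ∀ {W : DerivedCategory A} (h : W ⟶ s.obj X), h ≫ s.map p = 0 →
      ∃ q : W ⟶ s.obj K, h = q ≫ s.map i :=
    fun h hh => Pretriangulated.Triangle.coyoneda_exact₂ _ hT' h hh
  have w0 : i ≫ p = 0 := by
    apply s.map_injective
    rw [s.map_comp, s.map_zero]
    exact Pretriangulated.comp_distTriang_mor_zero₁₂ _ hT'
  have hepi : Epi p := by
    refine Preadditive.epi_of_cancel_zero _ fun {W} h hh => ?_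
    apply s.map_injective
    obtain ⟨q, hq⟩ := y3 (s.map h) (by rw [← s.map_comp, hh, s.map_zero])
    have : q = 0 := by
      have h1 := hLE1 K
      have h2 := hGE0 W
      exact tt.zero q (-1) 0
    rw [hq, this, s.map_zero, comp_zero]
  have hmono : Mono i := by
    refine Preadditive.mono_of_cancel_zero _ fun {W} h hh => ?_
    apply s.map_injective
    apply (shiftFunctor (DerivedCategory A) (1 : ℤ)).map_injective
    obtain ⟨q, hq⟩ := c1 ((s.map h)⟦(1 : ℤ)⟧') (by
        rw [← Functor.map_comp, ← s.map_comp, hh, s.map_zero, Functor.map_zero])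
    have : q = 0 := by
      have h1 := hLE1 W
      have h2 := hGE0 Y
      exact tt.zero q (-1) 0
    rw [hq, this, zero_comp, s.map_zero, Functor.map_zero]
  have hker : ∀ {W : A} (k : W ⟶ X), k ≫ p = 0 → ∃ l : W ⟶ K, l ≫ i = k := by
    intro W k hk
    obtain ⟨q, hq⟩ := c2 (s.map k) (by rw [← s.map_comp, hk, s.map_zero])
    obtain ⟨l, rfl⟩ := s.map_surjective q
    exact ⟨l, s.map_injective (by rw [s.map_comp, hq])⟩
  have hex : (ShortComplex.mk i p w0).Exact :=
    ShortComplex.exact_of_f_is_kernel _ (KernelFork.IsLimit.ofι' _ _ fun {W} k hk =>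
      ⟨(hker k hk).choose, (hker k hk).choose_spec⟩)
  have hS : (ShortComplex.mk i p w0).ShortExact := { exact := hex }
  refine ⟨X, i, p, w0, hS, ?_⟩
  have hc : ∃ c : s.obj Y ⟶ s.obj Y, s.map p ≫ c = 𝟙 (s.obj X) ≫ s.map p ∧
      hS.singleδ ≫ (𝟙 (s.obj K))⟦(1 : ℤ)⟧' = c ≫ x' :=
    Pretriangulated.complete_distinguished_triangle_morphism _ _
      hS.singleTriangle_distinguished hT' (𝟙 (s.obj K)) (𝟙 (s.obj X))
      ((Category.comp_id (s.map i)).trans (Category.id_comp (s.map i)).symm)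
  obtain ⟨c, hc1, hc2⟩ := hc
  obtain ⟨c, rfl⟩ := s.map_surjective c
  have hc : c = 𝟙 Y := by
    rw [← cancel_epi p]
    apply s.map_injective
    rw [Category.comp_id, s.map_comp, hc1, Category.id_comp]
  subst hc
  ext
  rw [ShortComplex.ShortExact.extClass_hom]
  rw [CategoryTheory.Functor.map_id, CategoryTheory.Functor.map_id, Category.id_comp, Category.comp_id] at hc2
  exact hc2

theorem exists_lift_iff {A : Type u} [Category.{v} A] [Abelian A] [HasExt.{w} A]
    {S : ShortComplex A} (hS : S.ShortExact) {T : A} (t : T ⟶ S.X₃) :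
    (∃ s : T ⟶ S.X₂, s ≫ S.g = t) ↔ (Ext.mk₀ t).comp hS.extClass (zero_add 1) = 0 := by
  constructor
  · rintro ⟨s, rfl⟩
    rw [← Ext.mk₀_comp_mk₀, Ext.comp_assoc (a₂₃ := 1) _ _ _ (by lia) (by lia) (by lia),
      hS.comp_extClass, Ext.comp_zero]
  · intro h
    obtain ⟨y, hy⟩ := Ext.covariant_sequence_exact₃ T hS (Ext.mk₀ t) (zero_add 1) h
    obtain ⟨s, rfl⟩ := (Ext.mk₀_bijective T S.X₂).2 y
    refine ⟨s, (Ext.mk₀_bijective T S.X₃).1 ?_⟩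
    rw [← hy, Ext.mk₀_comp_mk₀]

/-! ### Right equivalence classes of morphisms -/

section RightClasses

variable {A : Type u} [Category.{v} A]

/-- Morphisms with target `Y`. -/
structure MorTo (Y : A) where
  {src : A}
  hom : src ⟶ Y

/-- `α ≤ β` if and only if `α` factors through `β`. -/
instance (Y : A) : Preorder (MorTo Y) where
  le α β := ∃ u : α.src ⟶ β.src, u ≫ β.hom = α.hom
  le_refl α := ⟨𝟙 _, Category.id_comp _⟩
  le_trans α β γ := by
    rintro ⟨u, hu⟩ ⟨w, hw⟩
    exact ⟨u ≫ w, by rw [Category.assoc, hw, hu]⟩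

/-- The poset `[→Y⟩` of right equivalence classes of morphisms to `Y`. -/
abbrev RightClass (Y : A) : Type max u v := Antisymmetrization (MorTo Y) (· ≤ ·)

/-- The right equivalence class `[α⟩` of a morphism `α : X ⟶ Y`. -/
def rightClass {X Y : A} (α : X ⟶ Y) : RightClass Y := toAntisymmetrization (· ≤ ·) ⟨α⟩

/-- `α : X ⟶ Y` is right `C`-determined: if `t : T ⟶ Y` is such that `t ∘ φ` factors through `α`
for all `φ : C ⟶ T`, then `t` factors through `α`. -/
def IsRightDetermined (C : A) {X Y : A} (α : X ⟶ Y) : Prop :=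
  ∀ ⦃T : A⦄ (t : T ⟶ Y), (∀ φ : C ⟶ T, ∃ s : C ⟶ X, s ≫ α = φ ≫ t) → ∃ s : T ⟶ X, s ≫ α = t

/-- The subset `[→Y⟩_epi` of classes of epimorphisms. -/
def epiClasses (Y : A) : Set (RightClass Y) :=
  {c | ∃ (X : A) (α : X ⟶ Y), Epi α ∧ c = rightClass α}

/-- The subset `^C[→Y⟩` of classes of right `C`-determined morphisms. -/
def determinedClasses (C Y : A) : Set (RightClass Y) :=
  {c | ∃ (X : A) (α : X ⟶ Y), IsRightDetermined C α ∧ c = rightClass α}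

/-- The subset `^C[→Y⟩_epi = [→Y⟩_epi ∩ ^C[→Y⟩`. -/
def determinedEpiClasses (C Y : A) : Set (RightClass Y) :=
  epiClasses Y ∩ determinedClasses C Y

theorem rightClass_eq_iff {X X' Y : A} (α : X ⟶ Y) (β : X' ⟶ Y) :
    rightClass α = rightClass β ↔ (∃ u, u ≫ β = α) ∧ ∃ u, u ≫ α = β := by
  unfold rightClass
  exact Quotient.eq (r := AntisymmRel.setoid (MorTo Y) (· ≤ ·))

end RightClasses

/-- `K' ∈ add K`: the object `K'` is a direct summand of a finite direct sum of copies of `K`. -/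
def InAdd {A : Type u} [Category.{v} A] [Abelian A] (K K' : A) : Prop :=
  haveI : HasFiniteBiproducts A := Abelian.hasFiniteBiproducts
  ∃ n : ℕ, Nonempty (Retract K' (⨁ fun _ : Fin n => K))

/-! ### The stable categories -/

section Stable

/-- `f` is projectively trivial: it factors through any epimorphism ending at its target. -/
def ProjTrivial {A : Type u} [Category.{v} A] {X Y : A} (f : X ⟶ Y) : Prop :=
  ∀ ⦃Z : A⦄ (p : Z ⟶ Y), Epi p → ∃ s : X ⟶ Z, s ≫ p = f

/-- `f` is injectively trivial: it factors through any monomorphism starting at its source. -/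
def InjTrivial {A : Type u} [Category.{v} A] {X Y : A} (f : X ⟶ Y) : Prop :=
  ∀ ⦃Z : A⦄ (i : X ⟶ Z), Mono i → ∃ s : Z ⟶ Y, i ≫ s = f

variable (k : Type t) [CommRing k] (A : Type u) [Category.{v} A] [Abelian A] [Linear k A]

/-- Congruence modulo the ideal `𝒫` of projectively trivial morphisms. -/
def projRel : HomRel A := fun _ _ f g => ProjTrivial (f - g)

/-- Congruence modulo the ideal `ℐ` of injectively trivial morphisms. -/
def injRel : HomRel A := fun _ _ f g => InjTrivial (f - g)

variable {A}

theorem ProjTrivial.add {X Y : A} {f g : X ⟶ Y} (hf : ProjTrivial f) (hg : ProjTrivial g) :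
    ProjTrivial (f + g) := fun _ p hp => by
  obtain ⟨s, hs⟩ := hf p hp
  obtain ⟨s', hs'⟩ := hg p hp
  exact ⟨s + s', by rw [Preadditive.add_comp, hs, hs']⟩

theorem ProjTrivial.neg {X Y : A} {f : X ⟶ Y} (hf : ProjTrivial f) :
    ProjTrivial (-f) := fun _ p hp => by
  obtain ⟨s, hs⟩ := hf p hp
  exact ⟨-s, by rw [Preadditive.neg_comp, hs]⟩

theorem ProjTrivial.zero (X Y : A) : ProjTrivial (0 : X ⟶ Y) :=
  fun _ _ _ => ⟨0, zero_comp⟩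

theorem ProjTrivial.smul {X Y : A} {f : X ⟶ Y} (hf : ProjTrivial f) (a : k) :
    ProjTrivial (a • f) := fun _ p hp => by
  obtain ⟨s, hs⟩ := hf p hp
  exact ⟨a • s, by rw [Linear.smul_comp, hs]⟩

theorem ProjTrivial.precomp {W X Y : A} {f : X ⟶ Y} (hf : ProjTrivial f) (u : W ⟶ X) :
    ProjTrivial (u ≫ f) := fun _ p hp => by
  obtain ⟨s, hs⟩ := hf p hp
  exact ⟨u ≫ s, by rw [Category.assoc, hs]⟩

theorem ProjTrivial.postcomp {X Y Z : A} {f : X ⟶ Y} (hf : ProjTrivial f) (u : Y ⟶ Z) :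
    ProjTrivial (f ≫ u) := fun _ p hp => by
  obtain ⟨s, hs⟩ := hf (pullback.snd p u) inferInstance
  exact ⟨s ≫ pullback.fst p u, by rw [Category.assoc, pullback.condition, reassoc_of% hs]⟩

theorem InjTrivial.add {X Y : A} {f g : X ⟶ Y} (hf : InjTrivial f) (hg : InjTrivial g) :
    InjTrivial (f + g) := fun _ p hp => by
  obtain ⟨s, hs⟩ := hf p hp
  obtain ⟨s', hs'⟩ := hg p hp
  exact ⟨s + s', by rw [Preadditive.comp_add, hs, hs']⟩

theorem InjTrivial.neg {X Y : A} {f : X ⟶ Y} (hf : InjTrivial f) :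
    InjTrivial (-f) := fun _ p hp => by
  obtain ⟨s, hs⟩ := hf p hp
  exact ⟨-s, by rw [Preadditive.comp_neg, hs]⟩

theorem InjTrivial.zero (X Y : A) : InjTrivial (0 : X ⟶ Y) :=
  fun _ _ _ => ⟨0, comp_zero⟩

theorem InjTrivial.smul {X Y : A} {f : X ⟶ Y} (hf : InjTrivial f) (a : k) :
    InjTrivial (a • f) := fun _ p hp => by
  obtain ⟨s, hs⟩ := hf p hp
  exact ⟨a • s, by rw [Linear.comp_smul, hs]⟩

theorem InjTrivial.postcomp {X Y Z : A} {f : X ⟶ Y} (hf : InjTrivial f) (u : Y ⟶ Z) :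
    InjTrivial (f ≫ u) := fun _ p hp => by
  obtain ⟨s, hs⟩ := hf p hp
  exact ⟨s ≫ u, by rw [reassoc_of% hs]⟩

theorem InjTrivial.precomp {W X Y : A} {f : X ⟶ Y} (hf : InjTrivial f) (u : W ⟶ X) :
    InjTrivial (u ≫ f) := fun _ p hp => by
  obtain ⟨s, hs⟩ := hf (pushout.inr p u) inferInstance
  exact ⟨pushout.inl p u ≫ s, by rw [pushout.condition_assoc, hs]⟩

variable (A)

instance : Congruence (projRel A) where
  comp_left u f g h := by
    have := ProjTrivial.precomp h u
    rwa [Preadditive.comp_sub] at this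
  comp_right u h := by
    have := ProjTrivial.postcomp h u
    rwa [Preadditive.sub_comp] at this
  equivalence :=
    { refl := fun f => by unfold projRel; rw [sub_self]; exact ProjTrivial.zero _ _
      symm := fun h => by unfold projRel at h ⊢; rw [← neg_sub]; exact h.neg
      trans := fun h h' => by
        unfold projRel at h h' ⊢; rw [← sub_add_sub_cancel]; exact h.add h' }

instance : Congruence (injRel A) where
  comp_left u f g h := by
    have := InjTrivial.precomp h u
    rwa [Preadditive.comp_sub] at this
  comp_right u h := by
    have := InjTrivial.postcomp h u
    rwa [Preadditive.sub_comp] at this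
  equivalence :=
    { refl := fun f => by unfold injRel; rw [sub_self]; exact InjTrivial.zero _ _
      symm := fun h => by unfold injRel at h ⊢; rw [← neg_sub]; exact h.neg
      trans := fun h h' => by
        unfold injRel at h h' ⊢; rw [← sub_add_sub_cancel]; exact h.add h' }

theorem projRel_add ⦃X Y : A⦄ (f₁ f₂ g₁ g₂ : X ⟶ Y) (h : projRel A f₁ f₂) (h' : projRel A g₁ g₂) :
    projRel A (f₁ + g₁) (f₂ + g₂) := by
  unfold projRel at *
  rw [add_sub_add_comm]; exact h.add h'

theorem injRel_add ⦃X Y : A⦄ (f₁ f₂ g₁ g₂ : X ⟶ Y) (h : injRel A f₁ f₂) (h' : injRel A g₁ g₂) :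
    injRel A (f₁ + g₁) (f₂ + g₂) := by
  unfold injRel at *
  rw [add_sub_add_comm]; exact h.add h'

/-- The stable category `A̲ = A / 𝒫`: the objects are those of `A`, and the morphisms are the
morphisms of `A` modulo the projectively trivial ones. -/
abbrev PStable : Type u := Quotient (projRel A)

/-- The stable category `A̅ = A / ℐ`: the objects are those of `A`, and the morphisms are the
morphisms of `A` modulo the injectively trivial ones. -/
abbrev IStable : Type u := Quotient (injRel A)

instance : Preadditive (PStable A) := Quotient.preadditive _ (projRel_add A)
instance : Preadditive (IStable A) := Quotient.preadditive _ (injRel_add A)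

/-- The projection functor `A ⥤ A̲`. -/
abbrev toP : A ⥤ PStable A := Quotient.functor (projRel A)

/-- The projection functor `A ⥤ A̅`. -/
abbrev toI : A ⥤ IStable A := Quotient.functor (injRel A)

instance : (toP A).Additive := Quotient.functor_additive _ (projRel_add A)
instance : (toI A).Additive := Quotient.functor_additive _ (injRel_add A)

instance : Linear k (PStable A) := Quotient.linear k _ fun a _ _ f g h => by
  unfold projRel at *
  rw [← smul_sub]; exact h.smul k a
instance : Linear k (IStable A) := Quotient.linear k _ fun a _ _ f g h => by
  unfold injRel at *
  rw [← smul_sub]; exact h.smul k a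

instance : (toP A).Linear k := Quotient.linear_functor k _ _
instance : (toI A).Linear k := Quotient.linear_functor k _ _

variable {A}

theorem toP_map_eq_zero_iff {X Y : A} (f : X ⟶ Y) : (toP A).map f = 0 ↔ ProjTrivial f := by
  rw [← (toP A).map_zero X Y, Quotient.functor_map_eq_iff]
  unfold projRel
  rw [sub_zero]

theorem toI_map_eq_zero_iff {X Y : A} (f : X ⟶ Y) : (toI A).map f = 0 ↔ InjTrivial f := by
  rw [← (toI A).map_zero X Y, Quotient.functor_map_eq_iff]
  unfold injRel
  rw [sub_zero]

/-- The `k`-module `Hom̲(X, Y) = Hom(X, Y) / 𝒫(X, Y)`. -/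
abbrev PHom (X Y : A) := (toP A).obj X ⟶ (toP A).obj Y

/-- The `k`-module `Hom̅(X, Y) = Hom(X, Y) / ℐ(X, Y)`. -/
abbrev IHom (X Y : A) := (toI A).obj X ⟶ (toI A).obj Y

/-- The action of `Γ(C)ᵒᵖ`, where `Γ(C) = End(C)`, on `Hom̲(C, Y)` by precomposition. -/
instance (C Y : A) : Module (End C)ᵐᵒᵖ (PHom C Y) where
  smul a f := (toP A).map a.unop ≫ f
  one_smul f := (congrArg (· ≫ f) ((toP A).map_id C)).trans (Category.id_comp f)
  mul_smul a b f := (congrArg (· ≫ f) ((toP A).map_comp a.unop b.unop)).trans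
    (Category.assoc _ _ _)
  smul_zero _ := comp_zero
  smul_add _ _ _ := Preadditive.comp_add _ _ _ _ _ _
  add_smul a b f := (congrArg (· ≫ f) ((toP A).map_add (f := a.unop) (g := b.unop))).trans
    (Preadditive.add_comp _ _ _ _ _ _)
  zero_smul f := (congrArg (· ≫ f) ((toP A).map_zero C C)).trans zero_comp

theorem op_smul_def {C Y : A} (a : (End C)ᵐᵒᵖ) (f : PHom C Y) :
    a • f = (toP A).map a.unop ≫ f := rfl

end Stable

/-! ### Auslander-Reiten duality -/

section ARDuality

variable (k : Type t) [CommRing k] (E : Type t) [AddCommGroup E] [Module k E]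
variable (A : Type u) [Category.{v} A] [Abelian A] [Linear k A] [HasExt.{w} A]

/-- The `k`-module `D Ext¹(X, Y)`, where `D = Hom_k(-, E)`. -/
abbrev DExt {A : Type u} [Category.{v} A] [Abelian A] [Linear k A] [HasExt.{w} A] (X Y : A) :=
  Ext X Y 1 →ₗ[k] E

variable {A} in
/-- The map `D Ext¹(X, Y) → D Ext¹(X', Y)` induced by `f : X ⟶ X'`. -/
noncomputable def DExt.mapLeft {X X' : A} (f : X ⟶ X') (Y : A) (φ : DExt k E X Y) :
    DExt k E X' Y :=
  φ ∘ₗ (Ext.mk₀ f).precompOfLinear k Y (zero_add 1)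

variable {A} in
/-- The map `D Ext¹(X, Y') → D Ext¹(X, Y)` induced by `g : Y ⟶ Y'`. -/
noncomputable def DExt.mapRight (X : A) {Y Y' : A} (g : Y ⟶ Y') (φ : DExt k E X Y') :
    DExt k E X Y :=
  φ ∘ₗ (Ext.mk₀ g).postcompOfLinear k X (add_zero 1)

/-- Auslander-Reiten duality for `A`: a `k`-linear equivalence `τ : A̲ ⥤ A̅` (together with a
chosen quasi-inverse `τ⁻¹` and a natural isomorphism between `τ⁻¹ τ` and the identity), and
`k`-linear isomorphisms `Φ X Y : D Ext¹(X, Y) ≃ Hom̅(Y, τ X)` that are natural in `X` and `Y`. -/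
structure ARDuality where
  τ : PStable A ≌ IStable A
  additive_τ : τ.functor.Additive
  linear_τ : τ.functor.Linear k
  Φ (X Y : A) : DExt k E X Y ≃ₗ[k] ((toI A).obj Y ⟶ τ.functor.obj ((toP A).obj X))
  Φ_mapLeft {X X' : A} (f : X ⟶ X') (Y : A) (φ : DExt k E X Y) :
    Φ X' Y (DExt.mapLeft k E f Y φ) = Φ X Y φ ≫ τ.functor.map ((toP A).map f)
  Φ_mapRight (X : A) {Y Y' : A} (g : Y ⟶ Y') (φ : DExt k E X Y') :
    Φ X Y (DExt.mapRight k E X g φ) = (toI A).map g ≫ Φ X Y' φ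

namespace ARDuality

variable {k E A} (R : ARDuality k E A)

/-- The object `τ⁻¹ K` (the objects of `A̲` are the objects of `A`). -/
def tauInv (K : A) : A := (R.τ.inverse.obj ((toI A).obj K)).as

/-- The isomorphism `Hom̅(Y, τ X) ≃ Hom̲(τ⁻¹ Y, X)` given by applying `τ⁻¹` and composing with the
natural isomorphism `τ⁻¹ τ X ≅ X`. -/
noncomputable def homEquiv (X Y : A) :
    ((toI A).obj Y ⟶ R.τ.functor.obj ((toP A).obj X)) ≃ₗ[k] PHom (R.tauInv Y) X :=
  haveI := R.additive_τ
  haveI := R.linear_τ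
  LinearEquiv.ofBijective
    (Linear.rightComp k _ (R.τ.unitIso.inv.app ((toP A).obj X)) ∘ₗ R.τ.inverse.mapLinearMap k)
    (by
      constructor
      · intro f g h
        exact R.τ.inverse.map_injective ((cancel_mono _).1 h)
      · intro f
        obtain ⟨g, hg⟩ := R.τ.inverse.map_surjective
          ((show R.τ.inverse.obj ((toI A).obj Y) ⟶ (toP A).obj X from f) ≫
            R.τ.unitIso.hom.app ((toP A).obj X))
        refine ⟨g, ?_⟩
        change R.τ.inverse.map g ≫ _ = _
        rw [hg, Category.assoc, Iso.hom_inv_id_app]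
        exact Category.comp_id _)

theorem homEquiv_apply (X Y : A) (h : (toI A).obj Y ⟶ R.τ.functor.obj ((toP A).obj X)) :
    R.homEquiv X Y h = R.τ.inverse.map h ≫ R.τ.unitIso.inv.app ((toP A).obj X) := rfl

/-- The isomorphism `Ψ X Y : D Ext¹(X, Y) ≃ Hom̲(τ⁻¹ Y, X)` induced by `Φ X Y`. -/
noncomputable def Ψ (X Y : A) : DExt k E X Y ≃ₗ[k] PHom (R.tauInv Y) X :=
  (R.Φ X Y).trans (R.homEquiv X Y)

theorem Ψ_mapLeft {X X' : A} (f : X ⟶ X') (Y : A) (φ : DExt k E X Y) :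
    R.Ψ X' Y (DExt.mapLeft k E f Y φ) = R.Ψ X Y φ ≫ (toP A).map f := by
  change R.homEquiv X' Y (R.Φ X' Y _) = R.homEquiv X Y (R.Φ X Y φ) ≫ _
  rw [R.Φ_mapLeft, homEquiv_apply, homEquiv_apply, Functor.map_comp, Category.assoc]
  erw [Category.assoc]
  congr 1
  exact R.τ.unitIso.inv.naturality ((toP A).map f)

/-- The `k`-module `D Ext¹(X, Y)` is finitely generated if `A` is Hom-finite. -/
theorem finite_DExt (R : ARDuality k E A) (hfin : ∀ X Y : A, Module.Finite k (X ⟶ Y)) (X Y : A) :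
    Module.Finite k (DExt k E X Y) := by
  have := hfin (R.tauInv Y) X
  have : Module.Finite k (PHom (R.tauInv Y) X) :=
    Module.Finite.of_surjective ((toP A).mapLinearMap k) (toP A).map_surjective
  exact Module.Finite.equiv (R.Ψ X Y).symm

variable [IsArtinianRing k] (hE : IsMinimalInjectiveCogenerator k E)
  (hfin : ∀ X Y : A, Module.Finite k (X ⟶ Y))

/-- The canonical identification of `Ext¹(X, Y)` with `D (D Ext¹(X, Y))` by evaluation. -/
noncomputable def evalEquiv (X Y : A) : Ext X Y 1 ≃ₗ[k] (DExt k E X Y →ₗ[k] E) :=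
  haveI := R.finite_DExt hfin X Y
  LinearEquiv.ofBijective LinearMap.applyₗ (hE.eval_bijective (Ext X Y 1))

theorem evalEquiv_apply (X Y : A) (x : Ext X Y 1) (φ : DExt k E X Y) :
    R.evalEquiv hE hfin X Y x φ = φ x := rfl

/-- The isomorphism `DΨ : D Hom̲(τ⁻¹ Y, X) ≃ Ext¹(X, Y)`, the dual of `Ψ X Y` followed by the
identification of `D (D Ext¹(X, Y))` with `Ext¹(X, Y)`. -/
noncomputable def DΨ (X Y : A) (θ : PHom (R.tauInv Y) X →ₗ[k] E) : Ext X Y 1 :=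
  (R.evalEquiv hE hfin X Y).symm (θ ∘ₗ (R.Ψ X Y).toLinearMap)

theorem apply_DΨ (X Y : A) (θ : PHom (R.tauInv Y) X →ₗ[k] E) (φ : DExt k E X Y) :
    φ (R.DΨ hE hfin X Y θ) = θ (R.Ψ X Y φ) := by
  rw [← R.evalEquiv_apply hE hfin, DΨ, LinearEquiv.apply_symm_apply]
  rfl

end ARDuality

/-! ### The maps `κ`, `η` and `F` -/

/-- The class `[α⟩`, where `0 ⟶ K' ⟶ X ⟶ Y ⟶ 0`, with last map `α`, is any exact sequence of
class `x` in `Ext¹(Y, K')`; see `kappaClass_extClass`. -/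
noncomputable def kappaClass {A : Type u} [Category.{v} A] [Abelian A] [HasExt.{w} A]
    {Y K' : A} (x : Ext Y K' 1) : RightClass Y :=
  rightClass (exists_shortExact_extClass x).choose_spec.choose_spec.choose

theorem rightClass_eq_of_extClass_eq {A : Type u} [Category.{v} A] [Abelian A] [HasExt.{w} A]
    {X X' Y K' : A} {i : K' ⟶ X} {α : X ⟶ Y} {h : i ≫ α = 0} {i' : K' ⟶ X'} {α' : X' ⟶ Y}
    {h' : i' ≫ α' = 0} (hS : (ShortComplex.mk i α h).ShortExact)
    (hS' : (ShortComplex.mk i' α' h').ShortExact) (e : hS.extClass = hS'.extClass) :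
    rightClass α = rightClass α' :=
  (rightClass_eq_iff _ _).2
    ⟨(exists_lift_iff hS' α).2 (e ▸ hS.comp_extClass),
      (exists_lift_iff hS α').2 (e.symm ▸ hS'.comp_extClass)⟩

theorem kappaClass_extClass {A : Type u} [Category.{v} A] [Abelian A] [HasExt.{w} A]
    {X Y K' : A} (i : K' ⟶ X) (α : X ⟶ Y) (h : i ≫ α = 0)
    (hS : (ShortComplex.mk i α h).ShortExact) :
    kappaClass hS.extClass = rightClass α := by
  obtain ⟨h', hS', hx⟩ :=
    (exists_shortExact_extClass hS.extClass).choose_spec.choose_spec.choose_spec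
  exact rightClass_eq_of_extClass_eq hS' hS hx

namespace ARDuality

variable {k E A} (R : ARDuality k E A)

/-- If `0 ⟶ K' ⟶ X ⟶ Y ⟶ 0` is exact with `K' ∈ add K`, then the epimorphism `X ⟶ Y` is right
`τ⁻¹ K`-determined. -/
theorem isRightDetermined (hE : IsMinimalInjectiveCogenerator k E) {K K' : A} (hK : InAdd K K')
    {X Y : A} (i : K' ⟶ X) (α : X ⟶ Y) (h : i ≫ α = 0)
    (hS : (ShortComplex.mk i α h).ShortExact) : IsRightDetermined (R.tauInv K) α := by
  intro T s hs
  refine (exists_lift_iff hS s).2 ?_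
  set y := (Ext.mk₀ s).comp hS.extClass (zero_add 1) with hy
  have key : ∀ g : K' ⟶ K, y.comp (Ext.mk₀ g) (add_zero 1) = 0 := by
    intro g
    by_contra hne
    obtain ⟨χ, hχ⟩ := hE.exists_ne_zero (k := k) hne
    apply hχ
    obtain ⟨φ, hφ⟩ := (toP A).map_surjective (R.Ψ T K χ)
    let χ₀ : DExt k E (R.tauInv K) K := (R.Ψ (R.tauInv K) K).symm (𝟙 _)
    have hχ₀ : χ = DExt.mapLeft k E φ K χ₀ := by
      apply (R.Ψ T K).injective
      rw [Ψ_mapLeft, LinearEquiv.apply_symm_apply, ← hφ]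
      exact (Category.id_comp _).symm
    have h0 : (Ext.mk₀ φ).comp y (zero_add 1) = 0 := by
      rw [hy, ← Ext.comp_assoc (a₁₂ := 0) _ _ _ (by lia) (by lia) (by lia), Ext.mk₀_comp_mk₀]
      exact (exists_lift_iff hS (φ ≫ s)).1 (hs φ)
    rw [hχ₀]
    change χ₀ ((Ext.mk₀ φ).comp (y.comp (Ext.mk₀ g) (add_zero 1)) (zero_add 1)) = 0
    rw [← Ext.comp_assoc (a₁₂ := 1) _ _ _ (by lia) (by lia) (by lia), h0, Ext.zero_comp, map_zero]
  have : HasFiniteBiproducts A := Abelian.hasFiniteBiproducts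
  obtain ⟨n, ⟨r⟩⟩ := hK
  have hid : 𝟙 K' = ∑ j : Fin n, (r.i ≫ biproduct.π (fun _ : Fin n => K) j) ≫
      biproduct.ι (fun _ : Fin n => K) j ≫ r.r := by
    rw [← r.retract]
    conv_lhs => rw [← Category.id_comp r.r, ← biproduct.total]
    rw [Preadditive.sum_comp, Preadditive.comp_sum]
    simp only [Category.assoc]
  rw [← Ext.comp_mk₀_id y, hid, Ext.mk₀_sum, Ext.comp_sum]
  refine Finset.sum_eq_zero fun j _ => ?_
  rw [← Ext.mk₀_comp_mk₀, ← Ext.comp_assoc (a₁₂ := 1) _ _ _ (by lia) (by lia) (by lia), key,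
    Ext.zero_comp]

/-- The map `κ : Ext¹(Y, K') → ^C[→Y⟩_epi`, for `K' ∈ add K` and `C = τ⁻¹ K`, which sends the class
of an exact sequence `0 ⟶ K' ⟶ X ⟶ Y ⟶ 0`, with last map `α`, to `[α⟩`. -/
noncomputable def κ (hE : IsMinimalInjectiveCogenerator k E) {K K' : A} (hK : InAdd K K') (Y : A)
    (x : Ext Y K' 1) : determinedEpiClasses (R.tauInv K) Y :=
  ⟨kappaClass x, by
    obtain ⟨X, i, α, h, hS, rfl⟩ := exists_shortExact_extClass x
    rw [kappaClass_extClass]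
    exact ⟨⟨X, α, hS.epi_g, rfl⟩, ⟨X, α, R.isRightDetermined hE hK i α h hS, rfl⟩⟩⟩

end ARDuality

variable {A}

/-- The image of `Hom̲(C, α) : Hom̲(C, X) → Hom̲(C, Y)`, a `Γ(C)ᵒᵖ`-submodule of `Hom̲(C, Y)`. -/
def imagePHom (C : A) {X Y : A} (α : X ⟶ Y) : Submodule (End C)ᵐᵒᵖ (PHom C Y) where
  carrier := {f | ∃ h : PHom C X, h ≫ (toP A).map α = f}
  add_mem' := by
    rintro _ _ ⟨h, rfl⟩ ⟨h', rfl⟩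
    exact ⟨h + h', Preadditive.add_comp _ _ _ _ _ _⟩
  zero_mem' := ⟨0, zero_comp⟩
  smul_mem' := by
    rintro a _ ⟨h, rfl⟩
    exact ⟨a • h, Category.assoc _ _ _⟩

theorem imagePHom_mono (C : A) {Y : A} {α β : MorTo Y} (h : α ≤ β) :
    imagePHom C α.hom ≤ imagePHom C β.hom := by
  obtain ⟨u, hu⟩ := h
  rintro _ ⟨f, rfl⟩
  refine ⟨f ≫ (toP A).map u, ?_⟩
  rw [Category.assoc, ← Functor.map_comp, hu]

/-- The map `[α⟩ ↦ Im Hom̲(C, α)` on right equivalence classes. -/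
def imageClass (C : A) {Y : A} (c : RightClass Y) : Submodule (End C)ᵐᵒᵖ (PHom C Y) :=
  Quotient.liftOn c (fun α => imagePHom C α.hom) fun _ _ h =>
    le_antisymm (imagePHom_mono C h.1) (imagePHom_mono C h.2)

theorem imageClass_rightClass (C : A) {X Y : A} (α : X ⟶ Y) :
    imageClass C (rightClass α) = imagePHom C α := rfl

/-- Any `Γ(C)ᵒᵖ`-submodule of `Hom̲(C, Y)` is finitely generated if `A` is Hom-finite. -/
theorem PHom_fg [IsArtinianRing k] (hfin : ∀ X Y : A, Module.Finite k (X ⟶ Y)) {C Y : A}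
    (N : Submodule (End C)ᵐᵒᵖ (PHom C Y)) : N.FG := by
  have := hfin C Y
  have : Module.Finite k (PHom C Y) :=
    Module.Finite.of_surjective ((toP A).mapLinearMap k) (toP A).map_surjective
  let r : Submodule (End C)ᵐᵒᵖ (PHom C Y) → Submodule k (PHom C Y) := fun N =>
    { carrier := N
      add_mem' := N.add_mem
      zero_mem' := N.zero_mem
      smul_mem' := by
        intro a f hf
        have := N.smul_mem (MulOpposite.op (a • 𝟙 C : End C)) hf
        rw [op_smul_def, MulOpposite.unop_op, Functor.map_smul, CategoryTheory.Functor.map_id,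
          Linear.smul_comp, Category.id_comp] at this
        exact this }
  have hr : StrictMono r := fun N N' h => h
  have : WellFoundedGT (Submodule (End C)ᵐᵒᵖ (PHom C Y)) := hr.wellFoundedGT
  exact (isNoetherian_iff'.2 this).noetherian N

/-- The map `η : ^C[→Y⟩_epi → sub Hom̲(C, Y)`, `[α⟩ ↦ Im Hom̲(C, α)`, to the set of finitely
generated `Γ(C)ᵒᵖ`-submodules of `Hom̲(C, Y)`. -/
def η [IsArtinianRing k] (hfin : ∀ X Y : A, Module.Finite k (X ⟶ Y)) (C Y : A)
    (c : determinedEpiClasses C Y) : {N : Submodule (End C)ᵐᵒᵖ (PHom C Y) // N.FG} :=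
  ⟨imageClass C c.1, PHom_fg k hfin _⟩

variable {k E}

/-- The composite `F : D Hom̲(C', Y) → Ext¹(Y, K') → ^C[→Y⟩_epi → sub Hom̲(C, Y)` of `DΨ`, `κ` and
`η`, where `K' ∈ add K`, `C = τ⁻¹ K` and `C' = τ⁻¹ K'`. -/
noncomputable def ARDuality.F [IsArtinianRing k] (R : ARDuality k E A)
    (hE : IsMinimalInjectiveCogenerator k E) (hfin : ∀ X Y : A, Module.Finite k (X ⟶ Y))
    {K K' : A} (hK : InAdd K K') (Y : A) (θ : PHom (R.tauInv K') Y →ₗ[k] E) :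
    {N : Submodule (End (R.tauInv K))ᵐᵒᵖ (PHom (R.tauInv K) Y) // N.FG} :=
  η k hfin (R.tauInv K) Y (R.κ hE hK Y (R.DΨ hE hfin Y K' θ))

end ARDuality

end AuslanderBij

namespace AuslanderBij

/-! Write `ξ = DΨ θ` in `Ext¹(Y, K')` and represent it by an exact sequence `0 ⟶ K' ⟶ X ⟶ Y ⟶ 0`
with last map `α`. Then `F θ` is the image of `Hom̲(C, α)`, and membership of a stable morphism in
that image is tested by an obstruction in `Ext¹(C, K')`.

There are three translations. Since `α` is an epimorphism, every projectively trivial map to `Y`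
factors through it, so the stable class of `f : C ⟶ Y` lies in the image exactly when `f` itself
factors through `α` (`map_mem_imagePHom_iff`). By the long exact sequence of `Ext`, this happens
exactly when the pullback of `ξ` along `f` vanishes (`exists_lift_iff`). Finally, `E` is a
cogenerator, so this pullback vanishes if and only if every functional `χ` on `Ext¹(C, K')` kills
it. Naturality of `Ψ` in its first variable turns the value of `χ` on the pullback into `θ (f ∘ Ψ
χ)`, and `Ψ χ` runs through all of `Hom̲(C', C)` because `Ψ` is bijective
(`ARDuality.comp_DΨ_eq_zero_iff`).

The last equivalence holds for every source object and every kernel object; only at the end is it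
used for `C = τ⁻¹ K` and the kernel `K'`. -/

/-- If `α` is an epimorphism, then the class of `f` in `Hom̲(C, Y)` lies in the image of
`Hom̲(C, α)` if and only if `f` factors through `α`. -/
theorem map_mem_imagePHom_iff {A : Type u} [Category.{v} A] [Abelian A]
    {C X Y : A} (α : X ⟶ Y) [Epi α] (f : C ⟶ Y) :
    (toP A).map f ∈ imagePHom C α ↔ ∃ s : C ⟶ X, s ≫ α = f := by
  constructor
  · rintro ⟨h, hh⟩
    obtain ⟨h, rfl⟩ := (toP A).map_surjective h
    -- The lift `h` is correct only up to a projectively trivial error. That error factors through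
    -- the epimorphism `α`, so adding its lift `s` to `h` makes the factorization hold in `A`
    -- itself.
    have h0 : (toP A).map (f - h ≫ α) = 0 := by
      rw [Functor.map_sub, Functor.map_comp, hh, sub_self]
    obtain ⟨s, hs⟩ := (toP_map_eq_zero_iff _).1 h0 α inferInstance
    exact ⟨h + s, by rw [Preadditive.add_comp, hs, add_sub_cancel]⟩
  · rintro ⟨s, rfl⟩
    exact ⟨(toP A).map s, ((toP A).map_comp s α).symm⟩

/-- The pullback of `DΨ θ` along `f : C ⟶ Y` vanishes if and only if `θ` vanishes on all
composites `f ∘ g` with `g : τ⁻¹ K ⟶ C`. -/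
theorem ARDuality.comp_DΨ_eq_zero_iff {k : Type t} [CommRing k] [IsArtinianRing k]
    {E : Type t} [AddCommGroup E] [Module k E] (hE : IsMinimalInjectiveCogenerator k E)
    {A : Type u} [Category.{v} A] [Abelian A] [Linear k A] [HasExt.{w} A]
    (hfin : ∀ X Y : A, Module.Finite k (X ⟶ Y)) (R : ARDuality k E A) {C K Y : A}
    (θ : PHom (R.tauInv K) Y →ₗ[k] E) (f : C ⟶ Y) :
    (Ext.mk₀ f).comp (R.DΨ hE hfin Y K θ) (zero_add 1) = 0 ↔
      ∀ g : R.tauInv K ⟶ C, θ ((toP A).map g ≫ (toP A).map f) = 0 := by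
  -- Pullback along `f` is dual to `DExt.mapLeft`, which `Ψ` converts into postcomposition with `f`;
  -- evaluating at `DΨ θ` is, by construction, applying `θ` after `Ψ`.
  have key (χ : DExt k E C K) :
      χ ((Ext.mk₀ f).comp (R.DΨ hE hfin Y K θ) (zero_add 1)) =
        θ (R.Ψ C K χ ≫ (toP A).map f) := by
    rw [← R.Ψ_mapLeft, ← R.apply_DΨ hE hfin]
    rfl
  constructor
  · intro h g
    -- Surjectivity of `Ψ`: the functional to test with is the one corresponding to the stable class
    -- of `g`.
    have := key ((R.Ψ C K).symm ((toP A).map g))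
    rw [h, map_zero, LinearEquiv.apply_symm_apply] at this
    exact this.symm
  · intro h
    by_contra hne
    -- A nonzero class is detected by some functional with values in the cogenerator `E`. Its image
    -- under `Ψ` is only a stable morphism, but it has a representative `g` in `A`, to which the
    -- hypothesis applies.
    obtain ⟨χ, hχ⟩ := hE.exists_ne_zero (k := k) hne
    obtain ⟨g, hg⟩ := (toP A).map_surjective (R.Ψ C K χ)
    exact hχ (by rw [key, ← hg, h g])

end AuslanderBij

/-- Letting `g` run over morphisms of `A` rather than stable ones loses nothing, since every stable
morphism has a representative. The equality is one of underlying sets, so the right-hand side need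
not be shown separately to be a finitely generated submodule. -/
theorem proposition5p3
    {k : Type t} [CommRing k] [IsArtinianRing k]
    {E : Type t} [AddCommGroup E] [Module k E]
    (hE : AuslanderBij.IsMinimalInjectiveCogenerator k E)
    {A : Type u} [Category.{v} A] [Abelian A] [Linear k A] [HasExt.{w} A]
    (hfin : ∀ X Y : A, Module.Finite k (X ⟶ Y))
    (R : AuslanderBij.ARDuality k E A)
    {K K' : A} (hK : AuslanderBij.InAdd K K') (Y : A)
    (θ : AuslanderBij.PHom (R.tauInv K') Y →ₗ[k] E) :
    ((R.F hE hfin hK Y θ).1 : Set (AuslanderBij.PHom (R.tauInv K) Y)) =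
      {f | ∀ g : R.tauInv K' ⟶ R.tauInv K, θ ((AuslanderBij.toP A).map g ≫ f) = 0} := by
  obtain ⟨X, i, α, h, hS, hx⟩ :=
    AuslanderBij.exists_shortExact_extClass (R.DΨ hE hfin Y K' θ)
  have hF : (R.F hE hfin hK Y θ).1 = AuslanderBij.imagePHom (R.tauInv K) α := by
    -- `kappaClass` rests on a chosen extension; `kappaClass_extClass` replaces it by the sequence
    -- at hand, because sequences with the same class have right equivalent last maps.
    change AuslanderBij.imageClass _ (AuslanderBij.kappaClass (R.DΨ hE hfin Y K' θ)) = _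
    rw [← hx, AuslanderBij.kappaClass_extClass, AuslanderBij.imageClass_rightClass]
  have : Epi α := hS.epi_g
  ext f
  obtain ⟨f, rfl⟩ := (AuslanderBij.toP A).map_surjective f
  -- Both sides become conditions on an actual morphism `f`: a factorization through `α` on the
  -- left, and the vanishing of the pullback of `hS.extClass` along `f` on the right.
  rw [hF, SetLike.mem_coe, AuslanderBij.map_mem_imagePHom_iff, Set.mem_ofPred_eq,
    ← R.comp_DΨ_eq_zero_iff hE hfin, ← hx]
  exact AuslanderBij.exists_lift_iff hS f
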